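/- Let $n \ge 2$, let $(\mathsf X_i,\mathcal B_i,\mu_i)$, $i\in[n]=\{1,\dots,n\}$, be $\sigma$-finite measure spaces, and let $\pi$ be a probability density on $\mathsf X=\mathsf X_1\times\dots\times\mathsf X_n$ with respect to $\mu_1\times\dots\times\mu_n$, specified everywhere. For $\Gamma\subset[n]$ write $-\Gamma=[n]\setminus\Gamma$, $\mathsf X_\Gamma=\prod_{i\in\Gamma}\mathsf X_i$, $\mu_\Gamma=\prod_{i\in\Gamma}\mu_i$, and $x_\Gamma$ for the restriction of $x\in\mathsf X$ to the coordinates in $\Gamma$. For $\Lambda\subset[n]$ let $\pi_\Lambda(x_\Lambda)=\int_{\mathsf X_{-\Lambda}}\pi(x)\,\mu_{-\Lambda}(dx_{-\Lambda})$ be the marginal density (so $\pi_{[n]}=\pi$ and $\pi_\emptyset=1$). For $y \in \mathsf X_\Lambda$ with $0<\pi_\Lambda(y)<\infty$ let $\pi_{-\Lambda\mid\Lambda}(x_{-\Lambda}\mid y)=\pi(x)/\pi_\Lambda(y)$, where $x_\Lambda=y$, be the conditional density; for the other $y$ let $\pi_{-\Lambda\mid\Lambda}(\cdot\mid y)$ be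 an arbitrary probability density on $\mathsf X_{-\Lambda}$. Given $\Lambda\subset[n]$ with $|\Lambda|\le n-1$, $y\in\mathsf X_\Lambda$ and $1\le l\le n-|\Lambda|$, one step of the random-scan Gibbs sampler with block size $l$ targeting $\pi_{-\Lambda\mid\Lambda}(\cdot\mid y)$ is as follows. From the current state $z\in\mathsf X_{-\Lambda}$, let $x\in\mathsf X$ have $x_\Lambda=y$ and $x_{-\Lambda}=z$; choose $\Gamma\subset-\Lambda$ with $|\Gamma|=l$ uniformly at random; replace $x_\Gamma$ by a draw from $\pi_{\Gamma\mid-\Gamma}(\cdot\mid x_{-\Gamma})$; return the $-\Lambda$ coordinates of the result. Let $K$ be its transition kernel and $\varpi$ the probability measure with density $\pi_{-\Lambda\mid\Lambda}(\cdot\mid y)$. The spectral gap is \[ \mathrm{gap}(\Lambda,y,l)=1-\|K\|_\varpi,\qquad \|K\|_\varpi=\sup\Big\{\frac{\|Kf\|_{L^2(\varpi)}}{\|f\|_{L^2(\varpi)}}: f\in L^2(\varpi),\ \int f\,d\varpi=0,\ f\ne0\Big\} \] (the supremum being $0$ if there is no such $f$). For $1\le l\le m\le n$ let \[ \mathrm{Gap}(m,l)=\min_{\Lambda\subset[n],\,|\Lambda|=n-m}\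 \ \inf_{y\in\mathsf X_\Lambda,\ 0<\pi_\Lambda(y)<\infty}\mathrm{gap}(\Lambda,y,l), \] so that $\mathrm{Gap}(n,l)$ is the spectral gap of the random-scan Gibbs sampler with block size $l$ targeting $\pi$. Then, for $l\in\{1,\dots,n-1\}$ and $m\in\{l+1,\dots,n\}$, \[ \mathrm{Gap}(m,l)\ \ge\ \mathrm{Gap}(m,m-1)\,\mathrm{Gap}(m-1,l). \] In particular, for $l\in\{1,\dots,n-1\}$, \[ \mathrm{Gap}(n,l)\ \ge\ \prod_{m=l+1}^{n}\mathrm{Gap}(m,m-1). \] -/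

import Mathlib

open MeasureTheory
open scoped ENNReal

namespace SpectralTelescope

noncomputable section

/-! ### Spectral gap of a reversible transition kernel -/

/-- The Markov operator `K f (x) = ∫ f(x') K(x, dx')` of a transition kernel `K`. -/
def markovOp {E : Type*} [MeasurableSpace E] (K : E → Measure E) (f : E → ℝ) : E → ℝ :=
  fun x => ∫ x', f x' ∂(K x)

/-- `L²₀(ν)`: measurable, square integrable functions with `∫ f dν = 0`. -/
def L2Zero {E : Type*} [MeasurableSpace E] (ν : Measure E) : Set (E → ℝ) :=
  {f | Measurable f ∧ MemLp f 2 ν ∧ ∫ x, f x ∂ν = 0}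

/-- `‖K‖_ν`: the supremum of `‖K f‖_ν / ‖f‖_ν` over `f ∈ L²₀(ν)` that are nonzero in `L²(ν)`.
It is `0` when `L²₀(ν) = 0`. -/
def opNorm {E : Type*} [MeasurableSpace E] (ν : Measure E) (K : E → Measure E) : ℝ≥0∞ :=
  ⨆ f ∈ {f | f ∈ L2Zero ν ∧ eLpNorm f 2 ν ≠ 0}, eLpNorm (markovOp K f) 2 ν / eLpNorm f 2 ν

/-- The spectral gap `1 - ‖K‖_ν` (used for kernels `K` that are reversible with respect to the
probability measure `ν`, so that `‖K‖_ν ≤ 1`). -/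
def spectralGap {E : Type*} [MeasurableSpace E] (ν : Measure E) (K : E → Measure E) : ℝ :=
  1 - (opNorm ν K).toReal

/-! ### Conditional distributions and Gibbs samplers

`π` is a density on `X₁ × ⋯ × X_n` with respect to `μ₁ × ⋯ × μ_n`.  For `Γ ⊆ [n]`, the value
`(∫⋯∫⁻_Γ, π ∂μ) x` is the integral of `π` over the coordinates in `Γ`, the others being those of
`x`; so it is the marginal density `π_{-Γ}(x_{-Γ})`.  A point of `∏_{i ∈ Λ} X_i` is given
throughout as the restriction to `Λ` of a point `x` of the full product. -/

/-- `x_{-Γ}` is a good conditioning value: `0 < π_{-Γ}(x_{-Γ}) < ∞`. -/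
def Admissible {n : ℕ} {X : Fin n → Type*} [∀ i, MeasurableSpace (X i)]
    (μ : ∀ i, Measure (X i)) (π : (∀ i, X i) → ℝ≥0∞)
    (Γ : Finset (Fin n)) (x : ∀ i, X i) : Prop :=
  0 < (∫⋯∫⁻_Γ, π ∂μ) x ∧ (∫⋯∫⁻_Γ, π ∂μ) x < ∞

open Classical in
/-- The conditional density `π_{Γ ∣ -Γ}(w ∣ x_{-Γ}) = π(x') / π_{-Γ}(x_{-Γ})`, where `x'` agrees
with `w` on `Γ` and with `x` elsewhere.  When the conditioning value is not admissible, the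
density is the arbitrarily chosen one, `ρ Γ x_{-Γ}`. -/
def condDensity {n : ℕ} {X : Fin n → Type*} [∀ i, MeasurableSpace (X i)]
    (μ : ∀ i, Measure (X i)) (π : (∀ i, X i) → ℝ≥0∞)
    (ρ : (Γ : Finset (Fin n)) → (∀ i : ↥Γᶜ, X i) → (∀ i : Γ, X i) → ℝ≥0∞)
    (Γ : Finset (Fin n)) (x : ∀ i, X i) (w : ∀ i : Γ, X i) : ℝ≥0∞ :=
  if Admissible μ π Γ x then
    π (Function.updateFinset x Γ w) / (∫⋯∫⁻_Γ, π ∂μ) x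
  else ρ Γ (Γᶜ.restrict x) w

/-- The conditional distribution of the coordinates in `Γ` given that the others equal
`x_{-Γ}`. -/
def condLaw {n : ℕ} {X : Fin n → Type*} [∀ i, MeasurableSpace (X i)]
    (μ : ∀ i, Measure (X i)) (π : (∀ i, X i) → ℝ≥0∞)
    (ρ : (Γ : Finset (Fin n)) → (∀ i : ↥Γᶜ, X i) → (∀ i : Γ, X i) → ℝ≥0∞)
    (Γ : Finset (Fin n)) (x : ∀ i, X i) : Measure (∀ i : Γ, X i) :=
  (Measure.pi fun i : Γ => μ i).withDensity (condDensity μ π ρ Γ x)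

/-- One step of the random-scan Gibbs sampler with block size `l` that targets
`π_{-Λ ∣ Λ}(· ∣ x_Λ)`.  At the state `z`, form the full point with coordinates `x_Λ` on `Λ` and `z`
off `Λ`; choose `Γ ⊆ -Λ` with `|Γ| = l` uniformly; redraw the coordinates in `Γ` from
`π_{Γ ∣ -Γ}` given all the others; return the coordinates off `Λ`. -/
def gibbsKernel {n : ℕ} {X : Fin n → Type*} [∀ i, MeasurableSpace (X i)]
    (μ : ∀ i, Measure (X i)) (π : (∀ i, X i) → ℝ≥0∞)
    (ρ : (Γ : Finset (Fin n)) → (∀ i : ↥Γᶜ, X i) → (∀ i : Γ, X i) → ℝ≥0∞)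
    (Λ : Finset (Fin n)) (x : ∀ i, X i) (l : ℕ) (z : ∀ i : ↥Λᶜ, X i) :
    Measure (∀ i : ↥Λᶜ, X i) :=
  ((Λᶜ.powersetCard l).card : ℝ≥0∞)⁻¹ • ∑ Γ ∈ Λᶜ.powersetCard l,
    (condLaw μ π ρ Γ (Function.updateFinset x Λᶜ z)).map
      (fun w => Λᶜ.restrict (Function.updateFinset (Function.updateFinset x Λᶜ z) Γ w))

/-- `gap(Λ, x_Λ, l)`: the spectral gap of the sampler with block size `l` that targets
`π_{-Λ ∣ Λ}(· ∣ x_Λ)`. -/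
def gap {n : ℕ} {X : Fin n → Type*} [∀ i, MeasurableSpace (X i)]
    (μ : ∀ i, Measure (X i)) (π : (∀ i, X i) → ℝ≥0∞)
    (ρ : (Γ : Finset (Fin n)) → (∀ i : ↥Γᶜ, X i) → (∀ i : Γ, X i) → ℝ≥0∞)
    (Λ : Finset (Fin n)) (x : ∀ i, X i) (l : ℕ) : ℝ :=
  spectralGap (condLaw μ π ρ Λᶜ x) (gibbsKernel μ π ρ Λ x l)

/-- `Gap(m, l)`: the infimum of `gap(Λ, x_Λ, l)` over all `Λ ⊆ [n]` with `|Λ| = n - m` and all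
values `x_Λ` with `0 < π_Λ(x_Λ) < ∞`. -/
def Gap {n : ℕ} {X : Fin n → Type*} [∀ i, MeasurableSpace (X i)]
    (μ : ∀ i, Measure (X i)) (π : (∀ i, X i) → ℝ≥0∞)
    (ρ : (Γ : Finset (Fin n)) → (∀ i : ↥Γᶜ, X i) → (∀ i : Γ, X i) → ℝ≥0∞)
    (m l : ℕ) : ℝ :=
  sInf {g | ∃ (Λ : Finset (Fin n)) (x : ∀ i, X i),
    Λ.card = n - m ∧ Admissible μ π Λᶜ x ∧ g = gap μ π ρ Λ x l}

end

end SpectralTelescope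

namespace SpectralTelescope

open ProbabilityTheory Function

/-! Everything is lifted to the full product space. Fix an admissible conditioning value for the
block `S = Λᶜ`, and let `M` be the resulting conditional law, viewed as a measure on full points.
For `Γ ⊆ S` let `A Γ` be the operator on `L²(M)` that redraws the coordinates in `Γ`, i.e.
conditional expectation given the other coordinates. These are orthogonal projections with `A Γ (A Δ
v) = A Δ v` for `Γ ⊆ Δ`, and the Gibbs sampler with block size `l` acts as their average `T S l`
over the `Γ ⊆ S` with `l` elements.

A uniform `l`-subset of `S` can be drawn by first deleting a uniform `i ∈ S`, so `T S l` is the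
average over `i` of `T (S.erase i) l` (`blockAverage_eq`). The latter fixes the range of `A (S.erase
i)`. On the kernel of that projection it has norm at most `c = 1 - Gap(m-1, l)`, since on each fibre
it is a Gibbs sampler with one more coordinate frozen. Hence its quadratic form is at most `c‖v‖² +
(1 - c)⟪v, A (S.erase i) v⟫` (`inner_blockAverage_le`). Averaging over `i` turns the last term into
the form of the sampler with block size `m - 1`, at most `d‖v‖²` on mean-zero `v` with `d = 1 -
Gap(m, m-1)`. The total is `c + (1 - c)d = 1 - (1 - d)(1 - c)`. Because `T S l` is positive, this
bounds its norm (`norm_blockAverage_le_of_inner_le`).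

The arbitrary densities `ρ` matter only on an `M`-null set (`ae_admissible`). `ρ` need not be
measurable in the conditioning value, so the lifted kernels use a Dirac mass there instead. -/

theorem updateFinset_of_notMem_eq {n : ℕ} {X : Fin n → Type*} {Γ : Finset (Fin n)}
    {x : ∀ i, X i} (w : ∀ i : Γ, X i) : ∀ i ∉ Γ, x i = updateFinset x Γ w i :=
  fun i hi => by simp [updateFinset, hi]

/-! ### Conditional laws as Markov kernels on the full product space -/

section CondKernel

variable {n : ℕ} {X : Fin n → Type*} [∀ i, MeasurableSpace (X i)]
  {μ : ∀ i, Measure (X i)} {π : (∀ i, X i) → ℝ≥0∞} {Γ Δ : Finset (Fin n)} {x : ∀ i, X i}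

theorem Admissible.congr {y : ∀ i, X i} (h : ∀ i ∉ Γ, x i = y i) :
    Admissible μ π Γ x ↔ Admissible μ π Γ y := by
  unfold Admissible
  rw [lmarginal_congr μ π h]

theorem measurableSet_admissible [∀ i, SigmaFinite (μ i)] (hπ : Measurable π)
    (Γ : Finset (Fin n)) : MeasurableSet {x | Admissible μ π Γ x} :=
  (measurableSet_lt measurable_const (hπ.lmarginal μ)).inter
    (measurableSet_lt (hπ.lmarginal μ) measurable_const)

open Classical in
/-- The law of the full point after the coordinates in `Γ` of `x` are redrawn given the others;
the point does not move when the conditioning value is not admissible. -/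
noncomputable def condMeasure (μ : ∀ i, Measure (X i)) (π : (∀ i, X i) → ℝ≥0∞)
    (Γ : Finset (Fin n)) (x : ∀ i, X i) : Measure (∀ i, X i) :=
  if Admissible μ π Γ x then
    ((Measure.pi fun i : Γ => μ i).withDensity
      fun w => π (updateFinset x Γ w) / (∫⋯∫⁻_Γ, π ∂μ) x).map (updateFinset x Γ)
  else Measure.dirac x

theorem lintegral_condMeasure (hπ : Measurable π) (hx : Admissible μ π Γ x)
    {f : (∀ i, X i) → ℝ≥0∞} (hf : Measurable f) :
    ∫⁻ y, f y ∂(condMeasure μ π Γ x) =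
      (∫⋯∫⁻_Γ, (fun y => f y * π y) ∂μ) x / (∫⋯∫⁻_Γ, π ∂μ) x := by
  have hm : Measurable fun w : ∀ i : Γ, X i => π (updateFinset x Γ w) :=
    hπ.comp measurable_updateFinset
  have hm' : Measurable fun w : ∀ i : Γ, X i => f (updateFinset x Γ w) :=
    hf.comp measurable_updateFinset
  rw [condMeasure, if_pos hx, lintegral_map hf measurable_updateFinset,
    lintegral_withDensity_eq_lintegral_mul _ (hm.div_const _) hm', div_eq_mul_inv]
  generalize (∫⋯∫⁻_Γ, π ∂μ) x = c
  refine Eq.trans (lintegral_congr fun w => ?_) (lintegral_mul_const c⁻¹ (hm'.mul hm))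
  simp only [Pi.mul_apply, div_eq_mul_inv]
  ring

theorem condMeasure_of_not_admissible (hx : ¬ Admissible μ π Γ x) :
    condMeasure μ π Γ x = Measure.dirac x := if_neg hx

theorem condMeasure_congr (hπ : Measurable π) (hx : Admissible μ π Γ x) {y : ∀ i, X i}
    (h : ∀ i ∉ Γ, x i = y i) : condMeasure μ π Γ x = condMeasure μ π Γ y := by
  refine Measure.ext_of_lintegral _ fun f hf => ?_
  rw [lintegral_condMeasure hπ hx hf, lintegral_condMeasure hπ ((Admissible.congr h).1 hx) hf,
    lmarginal_congr μ _ h, lmarginal_congr μ π h]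

theorem measurable_condMeasure [∀ i, SigmaFinite (μ i)] (hπ : Measurable π)
    (Γ : Finset (Fin n)) : Measurable (condMeasure μ π Γ) := by
  classical
  refine Measure.measurable_of_measurable_coe _ fun s hs => ?_
  have hi : Measurable (s.indicator (1 : (∀ i, X i) → ℝ≥0∞)) := measurable_one.indicator hs
  have key : (fun x => condMeasure μ π Γ x s) = fun x =>
      if Admissible μ π Γ x then
        (∫⋯∫⁻_Γ, (fun y => s.indicator 1 y * π y) ∂μ) x / (∫⋯∫⁻_Γ, π ∂μ) x
      else s.indicator 1 x := by
    funext x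
    split_ifs with hx
    · rw [← lintegral_condMeasure hπ hx hi, lintegral_indicator_one hs]
    · rw [condMeasure_of_not_admissible hx, Measure.dirac_apply' _ hs]
  rw [key]
  exact Measurable.ite (measurableSet_admissible hπ Γ)
    (((hi.mul hπ).lmarginal μ).div (hπ.lmarginal μ)) hi

/-- `condMeasure` as a kernel on the full space. -/
noncomputable def condKernel [∀ i, SigmaFinite (μ i)] (hπ : Measurable π) (Γ : Finset (Fin n)) :
    Kernel (∀ i, X i) (∀ i, X i) :=
  ⟨condMeasure μ π Γ, measurable_condMeasure hπ Γ⟩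

theorem lmarginal_mul_of_forall {g f : (∀ i, X i) → ℝ≥0∞} (hf : Measurable f)
    (hg : ∀ w, g (updateFinset x Γ w) = g x) :
    (∫⋯∫⁻_Γ, (fun y => g y * f y) ∂μ) x = g x * (∫⋯∫⁻_Γ, f ∂μ) x := by
  simp only [lmarginal, hg]
  exact lintegral_const_mul _ (hf.comp measurable_updateFinset)

theorem ae_condMeasure_of_forall (hx : Admissible μ π Γ x) {p : (∀ i, X i) → Prop}
    (hp : MeasurableSet {y | p y}) (h : ∀ w, p (updateFinset x Γ w)) :
    ∀ᵐ y ∂(condMeasure μ π Γ x), p y := by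
  rw [condMeasure, if_pos hx, ae_map_iff measurable_updateFinset.aemeasurable hp]
  exact .of_forall h

variable [∀ i, SigmaFinite (μ i)]

theorem condKernel_apply (hπ : Measurable π) (Γ : Finset (Fin n)) (x : ∀ i, X i) :
    condKernel (μ := μ) hπ Γ x = condMeasure μ π Γ x := rfl

instance (hπ : Measurable π) (Γ : Finset (Fin n)) :
    IsMarkovKernel (condKernel (μ := μ) hπ Γ) := by
  refine ⟨fun x => ⟨?_⟩⟩
  rw [condKernel_apply]
  by_cases hx : Admissible μ π Γ x
  · rw [← lintegral_one, lintegral_condMeasure hπ hx measurable_const]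
    simp only [one_mul]
    exact ENNReal.div_self hx.1.ne' hx.2.ne
  · rw [condMeasure_of_not_admissible hx]
    simp

theorem lmarginal_eq_lmarginal_sdiff (hΓ : Γ ⊆ Δ) {f : (∀ i, X i) → ℝ≥0∞} (hf : Measurable f) :
    ∫⋯∫⁻_Δ, f ∂μ = ∫⋯∫⁻_Δ \ Γ, ∫⋯∫⁻_Γ, f ∂μ ∂μ := by
  rw [← lmarginal_union μ f hf Finset.sdiff_disjoint, Finset.sdiff_union_of_subset hΓ]

theorem ae_lmarginal_lt_top (hπ : Measurable π) (hΓ : Γ ⊆ Δ) (hx : Admissible μ π Δ x) :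
    ∀ᵐ w ∂(Measure.pi fun i : ↥(Δ \ Γ) => μ i),
      (∫⋯∫⁻_Γ, π ∂μ) (updateFinset x (Δ \ Γ) w) < ∞ := by
  refine ae_lt_top ((hπ.lmarginal μ).comp measurable_updateFinset) ?_
  have := hx.2.ne
  rwa [lmarginal_eq_lmarginal_sdiff hΓ hπ, lmarginal] at this

/-- Integrating the `Γ`-marginal over `Δ \ Γ` gives the finite `Δ`-marginal, so it is a.e. finite.
Where it vanishes there is no mass: admissibility does not depend on the `Γ` coordinates, so its
indicator factors out of the inner integral. -/
theorem ae_admissible (hπ : Measurable π) (hΓ : Γ ⊆ Δ) (hx : Admissible μ π Δ x) :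
    ∀ᵐ y ∂(condKernel (μ := μ) hπ Δ x), Admissible μ π Γ y := by
  classical
  have hs := (measurableSet_admissible (μ := μ) hπ Γ).compl
  have hi : Measurable ({y | Admissible μ π Γ y}ᶜ.indicator (1 : (∀ i, X i) → ℝ≥0∞)) :=
    measurable_one.indicator hs
  change condKernel (μ := μ) hπ Δ x {y | Admissible μ π Γ y}ᶜ = 0
  rw [← lintegral_indicator_one hs, condKernel_apply, lintegral_condMeasure hπ hx hi,
    ENNReal.div_eq_zero_iff]
  left
  rw [lmarginal_eq_lmarginal_sdiff (f := fun y => _ * π y) hΓ (hi.mul hπ)]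
  refine (lintegral_eq_zero_iff
    (((hi.mul hπ).lmarginal (f := fun y => _ * π y) μ).comp measurable_updateFinset)).2 ?_
  filter_upwards [ae_lmarginal_lt_top hπ hΓ hx] with w hw
  rw [Pi.zero_apply, Function.comp_apply, lmarginal_mul_of_forall hπ]
  · by_cases h : (∫⋯∫⁻_Γ, π ∂μ) (updateFinset x (Δ \ Γ) w) = 0
    · rw [h, mul_zero]
    · rw [Set.indicator_of_notMem, zero_mul]
      simpa using ⟨pos_iff_ne_zero.2 h, hw⟩
  · intro v
    simp only [Set.indicator, Set.mem_compl_iff, Set.mem_ofPred_eq, Pi.one_apply,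
      ← Admissible.congr (μ := μ) (π := π) (updateFinset_of_notMem_eq v)]

theorem condKernel_updateFinset (hπ : Measurable π) (hΓ : Γ ⊆ Δ) (hx : Admissible μ π Δ x)
    (w : ∀ i : Γ, X i) :
    condKernel (μ := μ) hπ Δ (updateFinset x Γ w) = condKernel (μ := μ) hπ Δ x :=
  (condMeasure_congr hπ hx fun i hi => updateFinset_of_notMem_eq w i fun h => hi (hΓ h)).symm

/-- Averages against `condKernel Δ` are not changed by a step of `condKernel Γ`, `Γ ⊆ Δ`. -/
theorem ae_integral_condKernel_eq (hπ : Measurable π) (hΓ : Γ ⊆ Δ) (hx : Admissible μ π Δ x)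
    {f : (∀ i, X i) → ℝ} (hf : Measurable f) :
    ∀ᵐ y ∂(condKernel (μ := μ) hπ Γ x),
      ∫ z, f z ∂(condKernel (μ := μ) hπ Δ y) = ∫ z, f z ∂(condKernel (μ := μ) hπ Δ x) := by
  have hF : Measurable fun y => ∫ z, f z ∂(condKernel (μ := μ) hπ Δ y) :=
    hf.stronglyMeasurable.integral_kernel.measurable
  have hs : MeasurableSet {y | ∫ z, f z ∂(condKernel (μ := μ) hπ Δ y) =
      ∫ z, f z ∂(condKernel (μ := μ) hπ Δ x)} := measurableSet_eq_fun hF measurable_const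
  rw [condKernel_apply hπ Γ]
  by_cases h : Admissible μ π Γ x
  · refine ae_condMeasure_of_forall h hs fun w => ?_
    rw [condKernel_updateFinset hπ hΓ hx]
  · rw [condMeasure_of_not_admissible h, ae_dirac_iff hs]

/-- Invariance on a single `Γ`-fibre. If the fibre has zero mass, `π` vanishes a.e. on it; otherwise
the inner average is constant along the fibre. -/
theorem lmarginal_lintegral_condKernel_mul (hπ : Measurable π) {f : (∀ i, X i) → ℝ≥0∞}
    (hf : Measurable f) (hx : (∫⋯∫⁻_Γ, π ∂μ) x < ∞) :
    (∫⋯∫⁻_Γ, (fun y => (∫⁻ z, f z ∂(condKernel (μ := μ) hπ Γ y)) * π y) ∂μ) x =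
      (∫⋯∫⁻_Γ, (fun y => f y * π y) ∂μ) x := by
  by_cases h0 : (∫⋯∫⁻_Γ, π ∂μ) x = 0
  · have h : ∀ g : (∀ i, X i) → ℝ≥0∞, (∫⋯∫⁻_Γ, (fun y => g y * π y) ∂μ) x = 0 := by
      intro g
      rw [lmarginal, lintegral_eq_zero_iff (f := fun w => π (updateFinset x Γ w))
        (hπ.comp measurable_updateFinset)] at h0
      rw [lmarginal, ← lintegral_zero]
      refine lintegral_congr_ae ?_
      filter_upwards [h0] with w hw
      rw [hw, Pi.zero_apply, mul_zero]
    rw [h, h]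
  · have ha : Admissible μ π Γ x := ⟨pos_iff_ne_zero.2 h0, hx⟩
    rw [lmarginal_mul_of_forall hπ fun w => by rw [condKernel_updateFinset hπ subset_rfl ha],
      condKernel_apply, lintegral_condMeasure hπ ha hf, ENNReal.div_mul_cancel h0 hx.ne]

theorem condKernel_invariant (hπ : Measurable π) (hΓ : Γ ⊆ Δ) (hx : Admissible μ π Δ x) :
    Kernel.Invariant (condKernel (μ := μ) hπ Γ) (condKernel (μ := μ) hπ Δ x) := by
  refine Measure.ext_of_lintegral _ fun f hf => ?_
  have hF : Measurable fun y => ∫⁻ z, f z ∂(condKernel (μ := μ) hπ Γ y) := hf.lintegral_kernel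
  rw [Measure.lintegral_bind (Kernel.aemeasurable _) hf.aemeasurable, condKernel_apply hπ Δ,
    lintegral_condMeasure hπ hx hF, lintegral_condMeasure hπ hx hf,
    lmarginal_eq_lmarginal_sdiff (f := fun y => _ * π y) hΓ (hF.mul hπ),
    lmarginal_eq_lmarginal_sdiff (f := fun y => f y * π y) hΓ (hf.mul hπ)]
  congr 1
  refine lintegral_congr_ae ?_
  filter_upwards [ae_lmarginal_lt_top hπ hΓ hx] with w hw
  exact lmarginal_lintegral_condKernel_mul hπ hf hw

end CondKernel

/-! ### Averages over blocks of fixed size -/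

section Averages

variable {ι : Type*}

/-- The average of `A Γ` over the subsets `Γ` of `S` with `l` elements. -/
noncomputable def blockAverage {V : Type*} [AddCommGroup V] [Module ℝ V]
    (A : Finset ι → V) (S : Finset ι) (l : ℕ) : V :=
  ((S.powersetCard l).card : ℝ)⁻¹ • ∑ Γ ∈ S.powersetCard l, A Γ

/-- Double counting: an `l`-subset `Γ` of `S` survives the deletion of `i` exactly when `i ∈ S \ Γ`.
-/
theorem sum_erase_powersetCard [DecidableEq ι] {V : Type*} [AddCommGroup V] [Module ℝ V]
    (A : Finset ι → V) (S : Finset ι) (l : ℕ) :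
    ∑ i ∈ S, ∑ Γ ∈ (S.erase i).powersetCard l, A Γ =
      ((S.card - l : ℕ) : ℝ) • ∑ Γ ∈ S.powersetCard l, A Γ := by
  rw [Finset.sum_comm' (s' := fun Γ => S \ Γ) (t' := S.powersetCard l), Finset.smul_sum]
  · refine Finset.sum_congr rfl fun Γ hΓ => ?_
    obtain ⟨h1, h2⟩ := Finset.mem_powersetCard.1 hΓ
    rw [Finset.sum_const, Finset.card_sdiff_of_subset h1, h2, Nat.cast_smul_eq_nsmul]
  · intro i Γ
    simp only [Finset.mem_powersetCard, Finset.mem_sdiff, Finset.subset_erase]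
    tauto

theorem blockAverage_eq [DecidableEq ι] {V : Type*} [AddCommGroup V] [Module ℝ V]
    (A : Finset ι → V) (S : Finset ι) {l : ℕ} (hl : l < S.card) :
    blockAverage A S l = (S.card : ℝ)⁻¹ • ∑ i ∈ S, blockAverage A (S.erase i) l := by
  obtain ⟨m, hm⟩ : ∃ m, S.card = m + 1 := ⟨S.card - 1, by omega⟩
  have h : ∀ i ∈ S, blockAverage A (S.erase i) l =
      ((m.choose l : ℕ) : ℝ)⁻¹ • ∑ Γ ∈ (S.erase i).powersetCard l, A Γ := fun i hi => by
    rw [blockAverage, Finset.card_powersetCard, Finset.card_erase_of_mem hi, hm,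
      Nat.add_sub_cancel]
  rw [Finset.sum_congr rfl h, ← Finset.smul_sum, sum_erase_powersetCard, blockAverage, smul_smul,
    smul_smul, Finset.card_powersetCard, hm]
  congr 1
  have hc : ((m + 1 : ℕ) : ℝ) * (m.choose l : ℕ) = ((m + 1).choose l : ℕ) * ((m + 1 - l : ℕ) : ℝ) :=
    by
    rw [mul_comm]
    exact_mod_cast Nat.choose_mul_succ_eq m l
  have h1 : ((m.choose l : ℕ) : ℝ) ≠ 0 :=
    mod_cast (Nat.choose_pos (by omega)).ne'
  have h2 : (((m + 1).choose l : ℕ) : ℝ) ≠ 0 :=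
    mod_cast (Nat.choose_pos (by omega)).ne'
  have h3 : ((m + 1 : ℕ) : ℝ) ≠ 0 := mod_cast m.succ_ne_zero
  field_simp
  linarith

theorem blockAverage_card {V : Type*} [AddCommGroup V] [Module ℝ V]
    (A : Finset ι → V) (S : Finset ι) : blockAverage A S S.card = A S := by
  simp [blockAverage]

end Averages

/-! ### Averages of orthogonal projections in an inner product space -/

section Hilbert

open scoped InnerProductSpace

variable {ι : Type*} {V : Type*} [NormedAddCommGroup V] [InnerProductSpace ℝ V]

/-- `P` is a symmetric idempotent. -/
def IsOrthoProj (P : V →ₗ[ℝ] V) : Prop := ∀ u v, ⟪P u, v⟫_ℝ = ⟪P u, P v⟫_ℝ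

variable {A : Finset ι → V →ₗ[ℝ] V} {S : Finset ι} {l : ℕ}

theorem IsOrthoProj.symm {P : V →ₗ[ℝ] V} (hP : IsOrthoProj P) (u v : V) :
    ⟪P u, v⟫_ℝ = ⟪u, P v⟫_ℝ := by
  rw [hP, real_inner_comm, ← hP, real_inner_comm]

theorem IsOrthoProj.norm_le {P : V →ₗ[ℝ] V} (hP : IsOrthoProj P) (v : V) : ‖P v‖ ≤ ‖v‖ := by
  have h := hP v v
  rw [real_inner_self_eq_norm_sq] at h
  have h2 := real_inner_le_norm (P v) v
  by_contra! hlt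
  nlinarith [norm_nonneg v]

theorem blockAverage_apply (A : Finset ι → V →ₗ[ℝ] V) (S : Finset ι) (l : ℕ) (v : V) :
    blockAverage A S l v = blockAverage (fun Γ => A Γ v) S l := by
  simp [blockAverage, LinearMap.sum_apply]

theorem inner_blockAverage (f : Finset ι → V) (S : Finset ι) (l : ℕ) (v : V) :
    ⟪v, blockAverage f S l⟫_ℝ = blockAverage (fun Γ => ⟪v, f Γ⟫_ℝ) S l := by
  simp [blockAverage, inner_smul_right, inner_sum]

theorem blockAverage_mono {f g : Finset ι → ℝ} (h : ∀ Γ ⊆ S, f Γ ≤ g Γ) :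
    blockAverage f S l ≤ blockAverage g S l := by
  unfold blockAverage
  gcongr with Γ hΓ
  exact h _ (Finset.mem_powersetCard.1 hΓ).1

theorem blockAverage_const (hl : l ≤ S.card) (c : V) :
    blockAverage (fun _ : Finset ι => c) S l = c := by
  have : (((S.card).choose l : ℕ) : ℝ) ≠ 0 := mod_cast (Nat.choose_pos hl).ne'
  rw [blockAverage, Finset.sum_const, Finset.card_powersetCard, ← Nat.cast_smul_eq_nsmul ℝ,
    smul_smul, inv_mul_cancel₀ this, one_smul]

theorem blockAverage_congr {f g : Finset ι → V} (h : ∀ Γ ⊆ S, f Γ = g Γ) :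
    blockAverage f S l = blockAverage g S l := by
  unfold blockAverage
  congr 1
  exact Finset.sum_congr rfl fun Γ hΓ => h _ (Finset.mem_powersetCard.1 hΓ).1

theorem norm_blockAverage_le (hA : ∀ Γ ⊆ S, IsOrthoProj (A Γ)) (hl : l ≤ S.card) (v : V) :
    ‖blockAverage A S l v‖ ≤ ‖v‖ := by
  rw [blockAverage_apply]
  calc ‖blockAverage (fun Γ => A Γ v) S l‖ ≤ blockAverage (fun Γ => ‖A Γ v‖) S l := by
        rw [blockAverage, norm_smul, blockAverage, norm_inv, Real.norm_natCast, smul_eq_mul]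
        gcongr
        exact norm_sum_le _ _
    _ ≤ blockAverage (fun _ => ‖v‖) S l := blockAverage_mono fun Γ hΓ => (hA Γ hΓ).norm_le v
    _ = ‖v‖ := blockAverage_const hl _

/-- For an average of orthogonal projections, a bound on the quadratic form on an invariant
subspace is a bound on the norm. -/
theorem norm_blockAverage_le_of_inner_le (hA : ∀ Γ ⊆ S, IsOrthoProj (A Γ)) {c : ℝ} (hc : 0 ≤ c)
    {W : Submodule ℝ V} (hW : ∀ Γ ⊆ S, ∀ v ∈ W, A Γ v ∈ W)
    (h : ∀ v ∈ W, ⟪v, blockAverage A S l v⟫_ℝ ≤ c * ‖v‖ ^ 2) {v : V} (hv : v ∈ W) :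
    ‖blockAverage A S l v‖ ≤ c * ‖v‖ := by
  set T := blockAverage A S l with hT
  have hTv : T v ∈ W := by
    rw [hT, blockAverage_apply]
    exact W.smul_mem _ (W.sum_mem fun Γ hΓ => hW Γ (Finset.mem_powersetCard.1 hΓ).1 v hv)
  -- Cauchy–Schwarz for the positive form of `T`, between `T v` and `v`, in weighted AM–GM form:
  -- each inner product of projected vectors is split with weight `s`.
  have key : ∀ s : ℝ, 0 < s → ‖T v‖ ^ 2 ≤ (s * ⟪T v, T (T v)⟫_ℝ + s⁻¹ * ⟪v, T v⟫_ℝ) / 2 := by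
    intro s hs
    have h1 : ∀ u, ⟪u, T u⟫_ℝ = blockAverage (fun Γ => ‖A Γ u‖ ^ 2) S l := fun u => by
      rw [hT, blockAverage_apply, inner_blockAverage]
      refine blockAverage_congr fun Γ hΓ => ?_
      rw [real_inner_comm, hA Γ hΓ, real_inner_self_eq_norm_sq]
    have h2 : ‖T v‖ ^ 2 = blockAverage (fun Γ => ⟪A Γ (T v), A Γ v⟫_ℝ) S l := by
      rw [← real_inner_self_eq_norm_sq]
      nth_rw 2 [hT]
      rw [blockAverage_apply, inner_blockAverage]
      refine blockAverage_congr fun Γ hΓ => ?_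
      rw [← (hA Γ hΓ).symm, hA Γ hΓ]
    have h3 : (s * ⟪T v, T (T v)⟫_ℝ + s⁻¹ * ⟪v, T v⟫_ℝ) / 2 =
        blockAverage (fun Γ => (s * ‖A Γ (T v)‖ ^ 2 + s⁻¹ * ‖A Γ v‖ ^ 2) / 2) S l := by
      rw [h1, h1]
      simp only [blockAverage, smul_eq_mul, ← Finset.sum_div, Finset.sum_add_distrib,
        ← Finset.mul_sum]
      ring
    rw [h2, h3]
    refine blockAverage_mono fun Γ _ => ?_
    have h4 := real_inner_le_norm (A Γ (T v)) (A Γ v)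
    have h5 : 0 ≤ s⁻¹ * (s * ‖A Γ (T v)‖ - ‖A Γ v‖) ^ 2 := by positivity
    have h6 : s⁻¹ * (s * ‖A Γ (T v)‖ - ‖A Γ v‖) ^ 2 =
        s * ‖A Γ (T v)‖ ^ 2 + s⁻¹ * ‖A Γ v‖ ^ 2 - 2 * (‖A Γ (T v)‖ * ‖A Γ v‖) := by
      field_simp
      ring
    linarith
  have hq1 := h v hv
  have hq2 := h _ hTv
  -- For `c > 0` the weight `s = c⁻¹` lets half of `‖T v‖²` be absorbed on the left. For `c = 0` the
  -- forms at `v` and `T v` are both nonpositive, so `s = 1` suffices.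
  rcases hc.eq_or_lt with rfl | hc
  · have := key 1 one_pos
    have : ‖T v‖ ^ 2 ≤ 0 := by simp only [one_mul, inv_one] at this; linarith
    rw [zero_mul]
    nlinarith [norm_nonneg (T v)]
  · have h1 := key c⁻¹ (by positivity)
    rw [inv_inv] at h1
    have h2 : c⁻¹ * ⟪T v, T (T v)⟫_ℝ ≤ ‖T v‖ ^ 2 := by
      rw [inv_mul_le_iff₀ hc]
      exact hq2
    have h3 : c * ⟪v, T v⟫_ℝ ≤ c * (c * ‖v‖ ^ 2) := by gcongr
    refine le_of_sq_le_sq ?_ (by positivity)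
    nlinarith

/-- The average is symmetric and fixes `P v`, so in the splitting `v = P v + (v - P v)` the cross
terms vanish; Pythagoras then gives the bound. -/
theorem inner_blockAverage_le {P : V →ₗ[ℝ] V} (hA : ∀ Γ ⊆ S, IsOrthoProj (A Γ))
    (hP : IsOrthoProj P) (hAP : ∀ Γ ⊆ S, ∀ v, A Γ (P v) = P v) (hl : l ≤ S.card) {c : ℝ}
    (h : ∀ v, ‖blockAverage A S l (v - P v)‖ ≤ c * ‖v - P v‖) (v : V) :
    ⟪v, blockAverage A S l v⟫_ℝ ≤ c * ‖v‖ ^ 2 + (1 - c) * ⟪v, P v⟫_ℝ := by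
  set T := blockAverage A S l with hT
  have hTP : T (P v) = P v := by
    rw [hT, blockAverage_apply, blockAverage_congr fun Γ hΓ => hAP Γ hΓ v, blockAverage_const hl]
  have hsymm : ∀ u w, ⟪u, T w⟫_ℝ = ⟪T u, w⟫_ℝ := fun u w => by
    rw [hT, blockAverage_apply, inner_blockAverage, blockAverage_apply, real_inner_comm,
      inner_blockAverage]
    refine blockAverage_congr fun Γ hΓ => ?_
    rw [← (hA Γ hΓ).symm, real_inner_comm]
  have hvP : ⟪v, P v⟫_ℝ = ‖P v‖ ^ 2 := by
    rw [real_inner_comm, hP, real_inner_self_eq_norm_sq]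
  have horth : ⟪P v, v - P v⟫_ℝ = 0 := by
    rw [inner_sub_right, real_inner_comm, hvP, real_inner_self_eq_norm_sq, sub_self]
  have hpyth : ‖v - P v‖ ^ 2 = ‖v‖ ^ 2 - ‖P v‖ ^ 2 := by
    rw [norm_sub_sq_real, hvP]
    ring
  have hdec : ⟪v, T v⟫_ℝ = ‖P v‖ ^ 2 + ⟪v - P v, T (v - P v)⟫_ℝ := by
    have h1 : ⟪P v, T (v - P v)⟫_ℝ = 0 := by rw [hsymm, hTP, horth]
    rw [inner_sub_left, h1, map_sub, hTP, inner_sub_right, hvP]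
    ring
  have hb : ⟪v - P v, T (v - P v)⟫_ℝ ≤ c * ‖v - P v‖ ^ 2 :=
    calc _ ≤ ‖v - P v‖ * ‖T (v - P v)‖ := real_inner_le_norm _ _
      _ ≤ ‖v - P v‖ * (c * ‖v - P v‖) := by gcongr; exact h v
      _ = _ := by ring
  rw [hdec, hvP]
  rw [hpyth] at hb
  linarith

/-- The spectral telescope for a family of orthogonal projections in a Hilbert space. -/
theorem norm_blockAverage_le_telescope [DecidableEq ι] (hA : ∀ Γ ⊆ S, IsOrthoProj (A Γ))
    (hAA : ∀ Δ ⊆ S, ∀ Γ ⊆ Δ, ∀ v, A Γ (A Δ v) = A Δ v) (hl : l < S.card) {c d : ℝ}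
    (hc0 : 0 ≤ c) (hc1 : c ≤ 1) (hd : 0 ≤ d)
    (hc : ∀ i ∈ S, ∀ v, ‖blockAverage A (S.erase i) l (v - A (S.erase i) v)‖ ≤
      c * ‖v - A (S.erase i) v‖)
    {W : Submodule ℝ V} (hW : ∀ Γ ⊆ S, ∀ v ∈ W, A Γ v ∈ W)
    (hdW : ∀ v ∈ W, ‖blockAverage A S (S.card - 1) v‖ ≤ d * ‖v‖) {v : V} (hv : v ∈ W) :
    ‖blockAverage A S l v‖ ≤ (1 - (1 - d) * (1 - c)) * ‖v‖ := by
  have hS : 0 < S.card := by omega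
  have hS' : (S.card : ℝ) ≠ 0 := mod_cast hS.ne'
  have hsub : ∀ i, ∀ Γ ⊆ S.erase i, Γ ⊆ S := fun i Γ h => h.trans (S.erase_subset i)
  refine norm_blockAverage_le_of_inner_le hA (by nlinarith) hW (fun v hv => ?_) hv
  have h1 : ∀ i ∈ S, ⟪v, blockAverage A (S.erase i) l v⟫_ℝ ≤
      c * ‖v‖ ^ 2 + (1 - c) * ⟪v, A (S.erase i) v⟫_ℝ := fun i hi =>
    inner_blockAverage_le (fun Γ hΓ => hA Γ (hsub i Γ hΓ)) (hA _ (S.erase_subset i))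
      (hAA _ (S.erase_subset i)) (by rw [Finset.card_erase_of_mem hi]; omega) (hc i hi) v
  -- With block size `S.card - 1`, each `S.erase i` contains a single block, itself.
  have h2 : blockAverage A S (S.card - 1) = (S.card : ℝ)⁻¹ • ∑ i ∈ S, A (S.erase i) := by
    rw [blockAverage_eq A S (by omega)]
    congr 1
    refine Finset.sum_congr rfl fun i hi => ?_
    rw [← Finset.card_erase_of_mem hi, blockAverage_card]
  have h3 : (S.card : ℝ)⁻¹ * ∑ i ∈ S, ⟪v, A (S.erase i) v⟫_ℝ ≤ d * ‖v‖ ^ 2 := by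
    have : (S.card : ℝ)⁻¹ * ∑ i ∈ S, ⟪v, A (S.erase i) v⟫_ℝ =
        ⟪v, blockAverage A S (S.card - 1) v⟫_ℝ := by
      rw [h2, LinearMap.smul_apply, LinearMap.sum_apply, inner_smul_right, inner_sum]
    rw [this]
    calc _ ≤ ‖v‖ * ‖blockAverage A S (S.card - 1) v‖ := real_inner_le_norm _ _
      _ ≤ ‖v‖ * (d * ‖v‖) := by gcongr; exact hdW v hv
      _ = _ := by ring
  rw [blockAverage_eq A S hl, LinearMap.smul_apply, LinearMap.sum_apply, inner_smul_right,
    inner_sum]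
  calc (S.card : ℝ)⁻¹ * ∑ i ∈ S, ⟪v, blockAverage A (S.erase i) l v⟫_ℝ
      ≤ (S.card : ℝ)⁻¹ * ∑ i ∈ S, (c * ‖v‖ ^ 2 + (1 - c) * ⟪v, A (S.erase i) v⟫_ℝ) := by
        gcongr with i hi
        exact h1 i hi
    _ = c * ‖v‖ ^ 2 + (1 - c) * ((S.card : ℝ)⁻¹ * ∑ i ∈ S, ⟪v, A (S.erase i) v⟫_ℝ) := by
        rw [Finset.sum_add_distrib, Finset.sum_const, nsmul_eq_mul, ← Finset.mul_sum]
        field_simp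
    _ ≤ c * ‖v‖ ^ 2 + (1 - c) * (d * ‖v‖ ^ 2) := by
        gcongr
    _ = _ := by ring

end Hilbert

/-! ### Invariant Markov kernels as operators on `L²` -/

section KernelOperator

open scoped InnerProductSpace

variable {E : Type*} [MeasurableSpace E] {M : Measure E} {κ : Kernel E E}

theorem eLpNorm_two_sq (f : E → ℝ) (M : Measure E) :
    eLpNorm f 2 M ^ 2 = ∫⁻ x, ‖f x‖ₑ ^ 2 ∂M := by
  have := eLpNorm_nnreal_pow_eq_lintegral (μ := M) (f := f) (p := 2) two_ne_zero
  simpa only [NNReal.coe_ofNat, ENNReal.coe_ofNat, ENNReal.rpow_ofNat] using this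

theorem eLpNorm_two_sq_eq_lintegral (h : κ.Invariant M) {f : E → ℝ} (hf : Measurable f) :
    eLpNorm f 2 M ^ 2 = ∫⁻ x, eLpNorm f 2 (κ x) ^ 2 ∂M := by
  have hm : Measurable fun x => ‖f x‖ₑ ^ 2 := hf.enorm.pow_const 2
  simp only [eLpNorm_two_sq]
  conv_lhs => rw [← h.def]
  exact Measure.lintegral_bind κ.aemeasurable hm.aemeasurable

theorem ae_ae_of_invariant (h : κ.Invariant M) {p : E → Prop} (hp : ∀ᵐ x ∂M, p x) :
    ∀ᵐ x ∂M, ∀ᵐ y ∂(κ x), p y := by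
  rw [← h.def] at hp
  exact Measure.ae_ae_of_ae_comp hp

theorem integral_eq_integral_integral [SFinite M] [IsSFiniteKernel κ] (h : κ.Invariant M)
    {f : E → ℝ} (hf : Integrable f M) : ∫ x, f x ∂M = ∫ x, ∫ y, f y ∂(κ x) ∂M := by
  have h1 : (κ ∘ₖ Kernel.const Unit M) () = M := by
    rw [← Measure.comp_eq_comp_const_apply]
    exact h.def
  have h2 := Kernel.integral_comp (η := κ) (κ := Kernel.const Unit M) (a := ()) (f := f)
    (by rwa [h1])
  rwa [h1, Kernel.const_apply] at h2

theorem ae_memLp_of_invariant (h : κ.Invariant M) {f : E → ℝ} (hf : Measurable f)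
    (hfM : MemLp f 2 M) : ∀ᵐ x ∂M, MemLp f 2 (κ x) := by
  have hm : Measurable fun x => eLpNorm f 2 (κ x) ^ 2 := by
    simp only [eLpNorm_two_sq]
    exact (hf.enorm.pow_const 2).lintegral_kernel
  have hfin : ∫⁻ x, eLpNorm f 2 (κ x) ^ 2 ∂M ≠ ∞ := by
    rw [← eLpNorm_two_sq_eq_lintegral h hf]
    exact ENNReal.pow_ne_top hfM.2.ne
  filter_upwards [ae_lt_top hm hfin] with x hx
  exact ⟨hf.aestronglyMeasurable, by simpa using hx⟩

theorem memLp_integral [IsMarkovKernel κ] (h : κ.Invariant M) {f : E → ℝ} (hf : Measurable f)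
    (hfM : MemLp f 2 M) : MemLp (fun x => ∫ y, f y ∂(κ x)) 2 M := by
  refine ⟨hf.stronglyMeasurable.integral_kernel.aestronglyMeasurable, ?_⟩
  have hle : ∀ x, ‖∫ y, f y ∂(κ x)‖ₑ ^ 2 ≤ eLpNorm f 2 (κ x) ^ 2 := fun x => by
    gcongr
    calc ‖∫ y, f y ∂(κ x)‖ₑ ≤ ∫⁻ y, ‖f y‖ₑ ∂(κ x) := enorm_integral_le_lintegral_enorm _
      _ = eLpNorm f 1 (κ x) := eLpNorm_one_eq_lintegral_enorm.symm
      _ ≤ eLpNorm f 2 (κ x) :=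
        eLpNorm_le_eLpNorm_of_exponent_le one_le_two hf.aestronglyMeasurable
  have hlt : eLpNorm (fun x => ∫ y, f y ∂(κ x)) 2 M ^ 2 < ∞ :=
    calc _ = ∫⁻ x, ‖∫ y, f y ∂(κ x)‖ₑ ^ 2 ∂M := eLpNorm_two_sq _ _
      _ ≤ ∫⁻ x, eLpNorm f 2 (κ x) ^ 2 ∂M := lintegral_mono hle
      _ = eLpNorm f 2 M ^ 2 := (eLpNorm_two_sq_eq_lintegral h hf).symm
      _ < ∞ := ENNReal.pow_lt_top hfM.2
  simpa using hlt

/-- An invariant Markov kernel acts linearly on `L²`. -/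
theorem exists_kernelOperator [IsProbabilityMeasure M] [IsMarkovKernel κ] (h : κ.Invariant M) :
    ∃ A : Lp ℝ 2 M →ₗ[ℝ] Lp ℝ 2 M, ∀ f, A f =ᵐ[M] fun x => ∫ y, f y ∂(κ x) := by
  have hL : ∀ f : Lp ℝ 2 M, MemLp (fun x => ∫ y, f y ∂(κ x)) 2 M := fun f =>
    memLp_integral h (Lp.stronglyMeasurable f).measurable (Lp.memLp f)
  have hint : ∀ f : Lp ℝ 2 M, ∀ᵐ x ∂M, Integrable f (κ x) := fun f =>
    (ae_memLp_of_invariant h (Lp.stronglyMeasurable f).measurable (Lp.memLp f)).mono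
      fun x hx => hx.integrable one_le_two
  refine ⟨{ toFun := fun f => (hL f).toLp _, map_add' := fun f g => ?_, map_smul' := fun c f => ?_ },
    fun f => (hL f).coeFn_toLp⟩
  · rw [← MemLp.toLp_add, MemLp.toLp_eq_toLp_iff]
    filter_upwards [hint f, hint g, ae_ae_of_invariant h (Lp.coeFn_add f g)] with x hf hg hfg
    rw [integral_congr_ae hfg, Pi.add_apply, ← integral_add hf hg]
    rfl
  · rw [RingHom.id_apply, ← MemLp.toLp_const_smul, MemLp.toLp_eq_toLp_iff]
    filter_upwards [ae_ae_of_invariant h (Lp.coeFn_smul c f)] with x hf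
    rw [integral_congr_ae hf, Pi.smul_apply, ← integral_smul]
    rfl

variable {A : Lp ℝ 2 M →ₗ[ℝ] Lp ℝ 2 M}

/-- By `hc`, `A u` is constant `κ x`-a.e. Disintegrating `⟪A u, v⟫` along `κ` lets that constant be
pulled out, leaving the average of `v`, which is `A v`. -/
theorem isOrthoProj_kernelOperator [IsProbabilityMeasure M] [IsMarkovKernel κ]
    (h : κ.Invariant M) (hA : ∀ f, A f =ᵐ[M] fun x => ∫ y, f y ∂(κ x))
    (hc : ∀ f : E → ℝ, Measurable f →
      ∀ᵐ x ∂M, ∀ᵐ y ∂(κ x), ∫ z, f z ∂(κ y) = ∫ z, f z ∂(κ x)) : IsOrthoProj A := by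
  intro u v
  have hi : Integrable (fun x => ⟪A u x, v x⟫_ℝ) M := L2.integrable_inner (A u) v
  rw [L2.inner_def, L2.inner_def, integral_eq_integral_integral h hi]
  refine integral_congr_ae ?_
  filter_upwards [hA u, hA v, ae_ae_of_invariant h (hA u),
    hc u (Lp.stronglyMeasurable u).measurable] with x hu hv hu' hx
  rw [hu, hv]
  have : ∀ᵐ y ∂(κ x), ⟪A u y, v y⟫_ℝ = v y * ∫ z, u z ∂(κ x) := by
    filter_upwards [hu', hx] with y h1 h2
    rw [h1, h2]
    rfl
  rw [integral_congr_ae this, integral_mul_const]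
  rfl

theorem kernelOperator_tower {η : Kernel E E} {B : Lp ℝ 2 M →ₗ[ℝ] Lp ℝ 2 M} [IsMarkovKernel κ]
    (h : κ.Invariant M)
    (hA : ∀ f, A f =ᵐ[M] fun x => ∫ y, f y ∂(κ x)) (hB : ∀ f, B f =ᵐ[M] fun x => ∫ y, f y ∂(η x))
    (hc : ∀ f : E → ℝ, Measurable f →
      ∀ᵐ x ∂M, ∀ᵐ y ∂(κ x), ∫ z, f z ∂(η y) = ∫ z, f z ∂(η x)) (v : Lp ℝ 2 M) :
    A (B v) = B v := by
  refine Lp.ext ?_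
  filter_upwards [hA (B v), hB v, ae_ae_of_invariant h (hB v),
    hc v (Lp.stronglyMeasurable v).measurable] with x h1 h2 h3 h4
  have : ∀ᵐ y ∂(κ x), B v y = ∫ z, v z ∂(η x) := by
    filter_upwards [h3, h4] with y h5 h6
    rw [h5, h6]
  rw [h1, h2, integral_congr_ae this]
  simp

theorem enorm_le_ofReal_mul_iff {V : Type*} [NormedAddCommGroup V] {u v : V} {c : ℝ}
    (hc : 0 ≤ c) : ‖u‖ₑ ≤ ENNReal.ofReal c * ‖v‖ₑ ↔ ‖u‖ ≤ c * ‖v‖ := by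
  rw [← ofReal_norm, ← ofReal_norm, ← ENNReal.ofReal_mul hc,
    ENNReal.ofReal_le_ofReal_iff (by positivity)]

/-- The functions with mean zero in `L²`. -/
noncomputable def meanZero (M : Measure E) [IsProbabilityMeasure M] : Submodule ℝ (Lp ℝ 2 M) where
  carrier := {f | ∫ x, f x ∂M = 0}
  add_mem' {f g} hf hg := by
    have hi : ∀ f : Lp ℝ 2 M, Integrable f M := fun f => (Lp.memLp f).integrable one_le_two
    simp only [Set.mem_ofPred_eq] at *
    rw [integral_congr_ae (Lp.coeFn_add f g)]
    simp only [Pi.add_apply]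
    rw [integral_add (hi f) (hi g), hf, hg, add_zero]
  zero_mem' := by
    simp only [Set.mem_ofPred_eq]
    rw [integral_congr_ae (Lp.coeFn_zero ℝ 2 M)]
    simp
  smul_mem' c f hf := by
    simp only [Set.mem_ofPred_eq] at *
    rw [integral_congr_ae (Lp.coeFn_smul c f)]
    simp only [Pi.smul_apply]
    rw [integral_smul, hf, smul_zero]

theorem mem_meanZero [IsProbabilityMeasure M] {f : Lp ℝ 2 M} :
    f ∈ meanZero M ↔ ∫ x, f x ∂M = 0 := Iff.rfl

theorem kernelOperator_mem_meanZero [IsProbabilityMeasure M] [IsMarkovKernel κ]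
    (h : κ.Invariant M) (hA : ∀ f, A f =ᵐ[M] fun x => ∫ y, f y ∂(κ x)) {f : Lp ℝ 2 M}
    (hf : f ∈ meanZero M) : A f ∈ meanZero M := by
  rw [mem_meanZero] at *
  rw [integral_congr_ae (hA f), ← hf,
    integral_eq_integral_integral h ((Lp.memLp f).integrable one_le_two)]

end KernelOperator

/-! ### The telescope for averages of kernels -/

section KernelAverage

variable {E : Type*} [MeasurableSpace E] {M : Measure E}
  {ι : Type*} {κ : Finset ι → Kernel E E} {S : Finset ι} {l : ℕ}

/-- The average over the blocks `Γ ⊆ S` with `l` elements of the Markov operators of `κ Γ`. -/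
noncomputable def kernelAverage (κ : Finset ι → Kernel E E) (S : Finset ι) (l : ℕ) (f : E → ℝ) :
    E → ℝ :=
  fun x => blockAverage (fun Γ => ∫ y, f y ∂(κ Γ x)) S l

theorem measurable_kernelAverage [∀ Γ, IsMarkovKernel (κ Γ)] {f : E → ℝ} (hf : Measurable f) :
    Measurable (kernelAverage κ S l f) := by
  unfold kernelAverage blockAverage
  exact Measurable.const_smul (Finset.measurable_fun_sum _ fun Γ _ =>
    hf.stronglyMeasurable.integral_kernel.measurable) ((S.powersetCard l).card : ℝ)⁻¹

theorem kernelAverage_congr (hinv : ∀ Γ ⊆ S, (κ Γ).Invariant M) {f g : E → ℝ}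
    (h : f =ᵐ[M] g) : kernelAverage κ S l f =ᵐ[M] kernelAverage κ S l g := by
  have h1 : ∀ᵐ x ∂M, ∀ Γ ∈ S.powerset, ∀ᵐ y ∂(κ Γ x), f y = g y :=
    (Filter.eventually_all_finset _).2 fun Γ hΓ =>
      ae_ae_of_invariant (hinv Γ (Finset.mem_powerset.1 hΓ)) h
  filter_upwards [h1] with x hx
  exact blockAverage_congr fun Γ hΓ => integral_congr_ae (hx Γ (Finset.mem_powerset.2 hΓ))

theorem coeFn_blockAverage {A : Finset ι → Lp ℝ 2 M →ₗ[ℝ] Lp ℝ 2 M}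
    (hA : ∀ Γ ⊆ S, ∀ f, A Γ f =ᵐ[M] fun x => ∫ y, f y ∂(κ Γ x)) (f : Lp ℝ 2 M) :
    blockAverage A S l f =ᵐ[M] kernelAverage κ S l f := by
  have h1 : ∀ᵐ x ∂M, ∀ Γ ∈ S.powersetCard l, A Γ f x = ∫ y, f y ∂(κ Γ x) :=
    (Filter.eventually_all_finset _).2 fun Γ hΓ => hA Γ (Finset.mem_powersetCard.1 hΓ).1 f
  rw [blockAverage_apply]
  unfold blockAverage kernelAverage
  filter_upwards [h1, Lp.coeFn_smul (((S.powersetCard l).card : ℝ)⁻¹)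
    (∑ Γ ∈ S.powersetCard l, A Γ f), Lp.coeFn_finsetSum (S.powersetCard l) fun Γ => A Γ f]
    with x hx hs hsum
  rw [hs, Pi.smul_apply, hsum, Finset.sum_apply, blockAverage]
  congr 1
  exact Finset.sum_congr rfl hx

theorem exists_kernelOperators [IsProbabilityMeasure M] [∀ Γ, IsMarkovKernel (κ Γ)]
    (hinv : ∀ Γ ⊆ S, (κ Γ).Invariant M) : ∃ A : Finset ι → Lp ℝ 2 M →ₗ[ℝ] Lp ℝ 2 M,
      ∀ Γ ⊆ S, ∀ f, A Γ f =ᵐ[M] fun x => ∫ y, f y ∂(κ Γ x) := by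
  choose! A hA using fun Γ (hΓ : Γ ⊆ S) => exists_kernelOperator (hinv Γ hΓ)
  exact ⟨A, hA⟩

theorem eLpNorm_kernelAverage_le [IsProbabilityMeasure M] [∀ Γ, IsMarkovKernel (κ Γ)]
    (hinv : ∀ Γ ⊆ S, (κ Γ).Invariant M)
    (hc : ∀ Γ ⊆ S, ∀ f : E → ℝ, Measurable f →
      ∀ᵐ x ∂M, ∀ᵐ y ∂(κ Γ x), ∫ z, f z ∂(κ Γ y) = ∫ z, f z ∂(κ Γ x))
    (hl : l ≤ S.card) {f : E → ℝ} (hf : MemLp f 2 M) :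
    eLpNorm (kernelAverage κ S l f) 2 M ≤ eLpNorm f 2 M := by
  obtain ⟨A, hA⟩ := exists_kernelOperators hinv
  have h := norm_blockAverage_le (l := l)
    (fun Γ hΓ => isOrthoProj_kernelOperator (hinv Γ hΓ) (hA Γ hΓ) (hc Γ hΓ)) hl (hf.toLp f)
  rw [← one_mul ‖hf.toLp f‖, ← enorm_le_ofReal_mul_iff zero_le_one, ENNReal.ofReal_one, one_mul,
    Lp.enorm_def, Lp.enorm_def, eLpNorm_congr_ae hf.coeFn_toLp,
    eLpNorm_congr_ae (coeFn_blockAverage hA _),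
    eLpNorm_congr_ae (kernelAverage_congr hinv hf.coeFn_toLp)] at h
  exact h

theorem eLpNorm_kernelAverage_le_telescope [IsProbabilityMeasure M] [DecidableEq ι]
    [∀ Γ, IsMarkovKernel (κ Γ)]
    (hinv : ∀ Γ ⊆ S, (κ Γ).Invariant M)
    (hconst : ∀ Δ ⊆ S, ∀ Γ ⊆ Δ, ∀ f : E → ℝ, Measurable f →
      ∀ᵐ x ∂M, ∀ᵐ y ∂(κ Γ x), ∫ z, f z ∂(κ Δ y) = ∫ z, f z ∂(κ Δ x))
    (hl : l < S.card) {c d : ℝ} (hc0 : 0 ≤ c) (hc1 : c ≤ 1) (hd0 : 0 ≤ d)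
    (hc : ∀ i ∈ S, ∀ᵐ x ∂M, ∀ f : E → ℝ, Measurable f → MemLp f 2 (κ (S.erase i) x) →
      ∫ y, f y ∂(κ (S.erase i) x) = 0 →
      eLpNorm (kernelAverage κ (S.erase i) l f) 2 (κ (S.erase i) x) ≤
        ENNReal.ofReal c * eLpNorm f 2 (κ (S.erase i) x))
    (hd : ∀ f : E → ℝ, Measurable f → MemLp f 2 M → ∫ y, f y ∂M = 0 →
      eLpNorm (kernelAverage κ S (S.card - 1) f) 2 M ≤ ENNReal.ofReal d * eLpNorm f 2 M)
    {f : E → ℝ} (hf : MemLp f 2 M) (hf0 : ∫ y, f y ∂M = 0) :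
    eLpNorm (kernelAverage κ S l f) 2 M ≤
      ENNReal.ofReal (1 - (1 - d) * (1 - c)) * eLpNorm f 2 M := by
  obtain ⟨A, hA⟩ := exists_kernelOperators hinv
  have hproj : ∀ Γ ⊆ S, IsOrthoProj (A Γ) := fun Γ hΓ =>
    isOrthoProj_kernelOperator (hinv Γ hΓ) (hA Γ hΓ) (hconst Γ hΓ Γ subset_rfl)
  have htower : ∀ Δ ⊆ S, ∀ Γ ⊆ Δ, ∀ v, A Γ (A Δ v) = A Δ v := fun Δ hΔ Γ hΓ =>
    kernelOperator_tower (hinv Γ (hΓ.trans hΔ)) (hA Γ (hΓ.trans hΔ)) (hA Δ hΔ) (hconst Δ hΔ Γ hΓ)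
  have hc' : ∀ i ∈ S, ∀ v, ‖blockAverage A (S.erase i) l (v - A (S.erase i) v)‖ ≤
      c * ‖v - A (S.erase i) v‖ := by
    intro i hi v
    have hΔ := S.erase_subset i
    set u := v - A (S.erase i) v with hu
    have hum := (Lp.stronglyMeasurable u).measurable
    -- So `u` has mean zero under almost every fibre law `κ (S.erase i) x`. The fibrewise bound then
    -- applies, and integrating its square over `M` gives the bound in `L²(M)`.
    have hu0 : A (S.erase i) u = 0 := by
      rw [hu, map_sub, htower _ hΔ _ subset_rfl, sub_self]
    have hmean : ∀ᵐ x ∂M, ∫ y, u y ∂(κ (S.erase i) x) = 0 := by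
      filter_upwards [hA _ hΔ u, Lp.coeFn_zero ℝ 2 M] with x h1 h2
      rw [← h1, hu0, h2, Pi.zero_apply]
    rw [← enorm_le_ofReal_mul_iff hc0, Lp.enorm_def, Lp.enorm_def,
      eLpNorm_congr_ae (coeFn_blockAverage (fun Γ hΓ => hA Γ (hΓ.trans hΔ)) u),
      ← ENNReal.pow_le_pow_left_iff two_ne_zero, mul_pow,
      eLpNorm_two_sq_eq_lintegral (hinv _ hΔ) (measurable_kernelAverage hum),
      eLpNorm_two_sq_eq_lintegral (hinv _ hΔ) hum,
      ← lintegral_const_mul' _ _ (ENNReal.pow_ne_top ENNReal.ofReal_ne_top)]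
    refine lintegral_mono_ae ?_
    filter_upwards [hc i hi, hmean, ae_memLp_of_invariant (hinv _ hΔ) hum (Lp.memLp u)]
      with x h1 h2 h3
    rw [← mul_pow]
    gcongr
    exact h1 u hum h3 h2
  have hd' : ∀ v ∈ meanZero M, ‖blockAverage A S (S.card - 1) v‖ ≤ d * ‖v‖ := by
    intro v hv
    rw [← enorm_le_ofReal_mul_iff hd0, Lp.enorm_def, Lp.enorm_def,
      eLpNorm_congr_ae (coeFn_blockAverage hA v)]
    exact hd v (Lp.stronglyMeasurable v).measurable (Lp.memLp v) hv
  have hv : hf.toLp f ∈ meanZero M := by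
    rw [mem_meanZero, integral_congr_ae hf.coeFn_toLp, hf0]
  have h := norm_blockAverage_le_telescope hproj htower hl hc0 hc1 hd0 hc'
    (fun Γ hΓ v hv => kernelOperator_mem_meanZero (hinv Γ hΓ) (hA Γ hΓ) hv) hd' hv
  rw [← enorm_le_ofReal_mul_iff (by nlinarith), Lp.enorm_def, Lp.enorm_def,
    eLpNorm_congr_ae hf.coeFn_toLp, eLpNorm_congr_ae (coeFn_blockAverage hA _),
    eLpNorm_congr_ae (kernelAverage_congr hinv hf.coeFn_toLp)] at h
  exact h

end KernelAverage

/-! ### From kernel averages back to Gibbs samplers and their gaps -/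

section Gap

variable {n : ℕ} {X : Fin n → Type*} [∀ i, MeasurableSpace (X i)]
  {μ : ∀ i, Measure (X i)} {π : (∀ i, X i) → ℝ≥0∞}
  {ρ : (Γ : Finset (Fin n)) → (∀ i : ↥Γᶜ, X i) → (∀ i : Γ, X i) → ℝ≥0∞}
  {Γ Λ S : Finset (Fin n)} {x : ∀ i, X i} {l m : ℕ}

theorem map_condLaw (hx : Admissible μ π Γ x) :
    (condLaw μ π ρ Γ x).map (updateFinset x Γ) = condMeasure μ π Γ x := by
  have : condDensity μ π ρ Γ x = fun w => π (updateFinset x Γ w) / (∫⋯∫⁻_Γ, π ∂μ) x := by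
    funext w
    rw [condDensity, if_pos hx]
  rw [condLaw, condMeasure, if_pos hx, this]

theorem gap_le_one : gap μ π ρ Λ x l ≤ 1 := sub_le_self _ ENNReal.toReal_nonneg

variable [∀ i, SigmaFinite (μ i)]

theorem markovOp_gibbsKernel (hπ : Measurable π) {z : ∀ i : ↥Λᶜ, X i}
    (hz : ∀ Γ ⊆ Λᶜ, Admissible μ π Γ (updateFinset x Λᶜ z)) {g : (∀ i : ↥Λᶜ, X i) → ℝ}
    (hg : Measurable g)
    (hi : ∀ Γ ⊆ Λᶜ, Integrable (fun y => g (Λᶜ.restrict y))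
      (condKernel (μ := μ) hπ Γ (updateFinset x Λᶜ z))) :
    markovOp (gibbsKernel μ π ρ Λ x l) g z =
      kernelAverage (condKernel (μ := μ) hπ) Λᶜ l (fun y => g (Λᶜ.restrict y))
        (updateFinset x Λᶜ z) := by
  have hr : Measurable (Λᶜ.restrict : (∀ i, X i) → ∀ i : ↥Λᶜ, X i) := Finset.measurable_restrict _
  have hm : ∀ Γ ∈ Λᶜ.powersetCard l,
      (condLaw μ π ρ Γ (updateFinset x Λᶜ z)).map
        (fun w => Λᶜ.restrict (updateFinset (updateFinset x Λᶜ z) Γ w)) =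
      (condKernel (μ := μ) hπ Γ (updateFinset x Λᶜ z)).map Λᶜ.restrict := fun Γ hΓ => by
    rw [condKernel_apply, ← map_condLaw (ρ := ρ) (hz Γ (Finset.mem_powersetCard.1 hΓ).1),
      Measure.map_map hr measurable_updateFinset]
    rfl
  have hint : ∀ Γ ∈ Λᶜ.powersetCard l, Integrable g
      ((condKernel (μ := μ) hπ Γ (updateFinset x Λᶜ z)).map Λᶜ.restrict) := fun Γ hΓ =>
    (integrable_map_measure hg.aestronglyMeasurable hr.aemeasurable).2
      (hi Γ (Finset.mem_powersetCard.1 hΓ).1)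
  rw [markovOp, gibbsKernel, Finset.sum_congr rfl hm, integral_smul_measure,
    integral_finsetSum_measure hint, kernelAverage, blockAverage]
  congr 1
  · simp
  · exact Finset.sum_congr rfl fun Γ _ =>
      integral_map hr.aemeasurable hg.aestronglyMeasurable

theorem ae_integral_condKernel_eq_of_subset (hπ : Measurable π) (hx : Admissible μ π S x) :
    ∀ Δ ⊆ S, ∀ Γ ⊆ Δ, ∀ f : (∀ i, X i) → ℝ, Measurable f →
      ∀ᵐ y ∂(condKernel (μ := μ) hπ S x), ∀ᵐ y' ∂(condKernel (μ := μ) hπ Γ y),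
        ∫ z, f z ∂(condKernel (μ := μ) hπ Δ y') = ∫ z, f z ∂(condKernel (μ := μ) hπ Δ y) := by
  intro Δ hΔ Γ hΓ f hf
  filter_upwards [ae_admissible hπ hΔ hx] with y hy
  exact ae_integral_condKernel_eq hπ hΓ hy hf

theorem eLpNorm_condKernelAverage_le (hπ : Measurable π) (hx : Admissible μ π S x)
    (hl : l ≤ S.card) {f : (∀ i, X i) → ℝ} (hf : MemLp f 2 (condKernel (μ := μ) hπ S x)) :
    eLpNorm (kernelAverage (condKernel (μ := μ) hπ) S l f) 2 (condKernel (μ := μ) hπ S x) ≤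
      eLpNorm f 2 (condKernel (μ := μ) hπ S x) :=
  eLpNorm_kernelAverage_le (κ := condKernel (μ := μ) hπ) (M := condKernel (μ := μ) hπ S x)
    (fun _ hΓ => condKernel_invariant hπ hΓ hx)
    (fun Γ hΓ => ae_integral_condKernel_eq_of_subset hπ hx Γ hΓ Γ subset_rfl) hl hf

theorem eLpNorm_markovOp_gibbsKernel (hπ : Measurable π) (hx : Admissible μ π Λᶜ x)
    {g : (∀ i : ↥Λᶜ, X i) → ℝ} (hg : Measurable g)
    (hg2 : MemLp (fun y => g (Λᶜ.restrict y)) 2 (condKernel (μ := μ) hπ Λᶜ x)) :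
    eLpNorm (markovOp (gibbsKernel μ π ρ Λ x l) g) 2 (condLaw μ π ρ Λᶜ x) =
      eLpNorm (kernelAverage (condKernel (μ := μ) hπ) Λᶜ l (fun y => g (Λᶜ.restrict y))) 2
        (condKernel (μ := μ) hπ Λᶜ x) := by
  have hG : Measurable fun y : ∀ i, X i => g (Λᶜ.restrict y) :=
    hg.comp (Finset.measurable_restrict _)
  have hM : (condLaw μ π ρ Λᶜ x).map (updateFinset x Λᶜ) = condKernel (μ := μ) hπ Λᶜ x :=
    map_condLaw hx
  have hae : ∀ᵐ y ∂(condKernel (μ := μ) hπ Λᶜ x), ∀ Γ ∈ Λᶜ.powerset, Admissible μ π Γ y ∧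
      Integrable (fun y => g (Λᶜ.restrict y)) (condKernel (μ := μ) hπ Γ y) :=
    (Filter.eventually_all_finset _).2 fun Γ hΓ => by
      have hΓ' := Finset.mem_powerset.1 hΓ
      filter_upwards [ae_admissible hπ hΓ' hx,
        ae_memLp_of_invariant (condKernel_invariant hπ hΓ' hx) hG hg2] with y h1 h2
      exact ⟨h1, h2.integrable one_le_two⟩
  rw [← hM] at hae ⊢
  rw [eLpNorm_map_measure (measurable_kernelAverage hG).aestronglyMeasurable
    measurable_updateFinset.aemeasurable]
  refine eLpNorm_congr_ae ?_
  filter_upwards [ae_of_ae_map measurable_updateFinset.aemeasurable hae] with z hz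
  exact markovOp_gibbsKernel hπ (fun Γ hΓ => (hz Γ (Finset.mem_powerset.2 hΓ)).1) hg
    fun Γ hΓ => (hz Γ (Finset.mem_powerset.2 hΓ)).2

theorem opNorm_gibbsKernel_le (hπ : Measurable π) (hx : Admissible μ π Λᶜ x) {c : ℝ≥0∞}
    (h : ∀ f : (∀ i, X i) → ℝ, Measurable f → MemLp f 2 (condKernel (μ := μ) hπ Λᶜ x) →
      ∫ y, f y ∂(condKernel (μ := μ) hπ Λᶜ x) = 0 →
      eLpNorm (kernelAverage (condKernel (μ := μ) hπ) Λᶜ l f) 2 (condKernel (μ := μ) hπ Λᶜ x) ≤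
        c * eLpNorm f 2 (condKernel (μ := μ) hπ Λᶜ x)) :
    opNorm (condLaw μ π ρ Λᶜ x) (gibbsKernel μ π ρ Λ x l) ≤ c := by
  have hM : (condLaw μ π ρ Λᶜ x).map (updateFinset x Λᶜ) = condKernel (μ := μ) hπ Λᶜ x :=
    map_condLaw hx
  refine iSup₂_le fun g hg => ?_
  obtain ⟨⟨hgm, hg2, hg0⟩, -⟩ := hg
  have hG : Measurable fun y : ∀ i, X i => g (Λᶜ.restrict y) :=
    hgm.comp (Finset.measurable_restrict _)
  have hGg : (fun y => g (Λᶜ.restrict y)) ∘ updateFinset x Λᶜ = g := by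
    funext z
    rw [Function.comp_apply, restrict_updateFinset]
  have hnorm : eLpNorm (fun y => g (Λᶜ.restrict y)) 2 (condKernel (μ := μ) hπ Λᶜ x) =
      eLpNorm g 2 (condLaw μ π ρ Λᶜ x) := by
    rw [← hM, eLpNorm_map_measure hG.aestronglyMeasurable measurable_updateFinset.aemeasurable,
      hGg]
  have hmem : MemLp (fun y => g (Λᶜ.restrict y)) 2 (condKernel (μ := μ) hπ Λᶜ x) :=
    ⟨hG.aestronglyMeasurable, hnorm ▸ hg2.2⟩
  have hint : ∫ y, g (Λᶜ.restrict y) ∂(condKernel (μ := μ) hπ Λᶜ x) = 0 := by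
    rw [← hM, integral_map measurable_updateFinset.aemeasurable hG.aestronglyMeasurable, ← hg0]
    exact congrArg (fun f => ∫ z, f z ∂(condLaw μ π ρ Λᶜ x)) hGg
  refine ENNReal.div_le_of_le_mul ?_
  rw [eLpNorm_markovOp_gibbsKernel hπ hx hgm hmem, ← hnorm]
  exact h _ hG hmem hint

theorem opNorm_gibbsKernel_le_one (hπ : Measurable π) (hx : Admissible μ π Λᶜ x)
    (hl : l ≤ Λᶜ.card) : opNorm (condLaw μ π ρ Λᶜ x) (gibbsKernel μ π ρ Λ x l) ≤ 1 :=
  opNorm_gibbsKernel_le hπ hx fun _ _ hf _ => by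
    rw [one_mul]
    exact eLpNorm_condKernelAverage_le hπ hx hl hf

/-- Converse transfer to `opNorm_gibbsKernel_le`. A function on the full space may depend on the
frozen coordinates, but the conditional law fixes these, so `f` agrees a.e. with a function of the
coordinates off `Λ`. -/
theorem eLpNorm_kernelAverage_le_gap (hπ : Measurable π) (hx : Admissible μ π Λᶜ x)
    (hl : l ≤ Λᶜ.card) {f : (∀ i, X i) → ℝ} (hf : Measurable f)
    (hf2 : MemLp f 2 (condKernel (μ := μ) hπ Λᶜ x))
    (hf0 : ∫ y, f y ∂(condKernel (μ := μ) hπ Λᶜ x) = 0) :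
    eLpNorm (kernelAverage (condKernel (μ := μ) hπ) Λᶜ l f) 2 (condKernel (μ := μ) hπ Λᶜ x) ≤
      ENNReal.ofReal (1 - gap μ π ρ Λ x l) * eLpNorm f 2 (condKernel (μ := μ) hπ Λᶜ x) := by
  have hM : (condLaw μ π ρ Λᶜ x).map (updateFinset x Λᶜ) = condKernel (μ := μ) hπ Λᶜ x :=
    map_condLaw hx
  -- Finiteness of the norm is essential: `toReal` would send `∞` to `0`.
  have hgap : ENNReal.ofReal (1 - gap μ π ρ Λ x l) =
      opNorm (condLaw μ π ρ Λᶜ x) (gibbsKernel μ π ρ Λ x l) := by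
    rw [gap, spectralGap, sub_sub_cancel, ENNReal.ofReal_toReal]
    exact ne_top_of_le_ne_top ENNReal.one_ne_top (opNorm_gibbsKernel_le_one hπ hx hl)
  by_cases h0 : eLpNorm f 2 (condKernel (μ := μ) hπ Λᶜ x) = 0
  · exact (eLpNorm_condKernelAverage_le hπ hx hl hf2).trans (by rw [h0]; exact zero_le)
  set g : (∀ i : ↥Λᶜ, X i) → ℝ := f ∘ updateFinset x Λᶜ with hg
  have hgm : Measurable g := hf.comp measurable_updateFinset
  have hG : Measurable fun y : ∀ i, X i => g (Λᶜ.restrict y) :=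
    hgm.comp (Finset.measurable_restrict _)
  have hae : (fun y => g (Λᶜ.restrict y)) =ᵐ[condKernel (μ := μ) hπ Λᶜ x] f := by
    rw [condKernel_apply]
    refine ae_condMeasure_of_forall hx (measurableSet_eq_fun hG hf) fun w => ?_
    simp only [hg, comp_apply, restrict_updateFinset]
  have hnorm : eLpNorm f 2 (condKernel (μ := μ) hπ Λᶜ x) = eLpNorm g 2 (condLaw μ π ρ Λᶜ x) := by
    rw [← hM, eLpNorm_map_measure hf.aestronglyMeasurable measurable_updateFinset.aemeasurable]
  have hmem : g ∈ L2Zero (condLaw μ π ρ Λᶜ x) := by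
    refine ⟨hgm, ⟨hgm.aestronglyMeasurable, hnorm ▸ hf2.2⟩, ?_⟩
    rw [← hf0, ← hM, integral_map measurable_updateFinset.aemeasurable hf.aestronglyMeasurable]
    rfl
  have hK := kernelAverage_congr (κ := condKernel (μ := μ) hπ) (l := l)
    (M := condKernel (μ := μ) hπ Λᶜ x) (fun Γ hΓ => condKernel_invariant hπ hΓ hx) hae
  rw [← eLpNorm_congr_ae hK,
    ← eLpNorm_markovOp_gibbsKernel (ρ := ρ) hπ hx hgm ((memLp_congr_ae hae).2 hf2), hgap, hnorm]
  rw [← ENNReal.div_le_iff (hnorm ▸ h0) (hnorm ▸ hf2.2.ne)]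
  exact le_iSup₂ (f := fun f (_ : f ∈ {f | f ∈ L2Zero (condLaw μ π ρ Λᶜ x) ∧
    eLpNorm f 2 (condLaw μ π ρ Λᶜ x) ≠ 0}) => eLpNorm (markovOp (gibbsKernel μ π ρ Λ x l) f) 2
      (condLaw μ π ρ Λᶜ x) / eLpNorm f 2 (condLaw μ π ρ Λᶜ x)) g ⟨hmem, hnorm ▸ h0⟩

theorem gap_nonneg (hπ : Measurable π) (hx : Admissible μ π Λᶜ x) (hl : l ≤ Λᶜ.card) :
    0 ≤ gap μ π ρ Λ x l := by
  rw [gap, spectralGap, sub_nonneg]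
  exact ENNReal.toReal_le_of_le_ofReal zero_le_one
    (by simpa using opNorm_gibbsKernel_le_one hπ hx hl)

theorem card_compl_of_card_eq (hm : m ≤ n) (hΛ : Λ.card = n - m) : Λᶜ.card = m := by
  rw [Finset.card_compl, Fintype.card_fin, hΛ]
  omega

theorem Gap_le_gap (hπ : Measurable π) (hm : m ≤ n) (hl : l ≤ m) (hΛ : Λ.card = n - m)
    (hx : Admissible μ π Λᶜ x) : Gap μ π ρ m l ≤ gap μ π ρ Λ x l := by
  refine csInf_le ⟨0, ?_⟩ ⟨Λ, x, hΛ, hx, rfl⟩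
  rintro _ ⟨Λ, x, hΛ, hx, rfl⟩
  exact gap_nonneg hπ hx (by rwa [card_compl_of_card_eq hm hΛ])

theorem Gap_nonneg (hπ : Measurable π) (hm : m ≤ n) (hl : l ≤ m) : 0 ≤ Gap μ π ρ m l := by
  refine Real.sInf_nonneg ?_
  rintro _ ⟨Λ, x, hΛ, hx, rfl⟩
  exact gap_nonneg hπ hx (by rwa [card_compl_of_card_eq hm hΛ])

/-- Under the law `π` itself (the block `univ`, with marginal `1`) almost every point is admissible.
This makes the set defining `Gap` nonempty, as `le_csInf` requires. -/
theorem exists_admissible (hπ : Measurable π) (hπ1 : ∫⁻ x, π x ∂(Measure.pi μ) = 1)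
    (Γ : Finset (Fin n)) : ∃ x, Admissible μ π Γ x := by
  have hne : Nonempty (∀ i, X i) := by
    by_contra h
    rw [not_nonempty_iff] at h
    simp at hπ1
  obtain ⟨x⟩ := hne
  have hx : Admissible μ π Finset.univ x := by
    simp [Admissible, hπ1]
  exact (ae_admissible hπ (Finset.subset_univ Γ) hx).exists

theorem mul_Gap_le_gap (hπ : Measurable π) (hlm : l < m) (hm : m ≤ n) (hΛ : Λ.card = n - m)
    (hx : Admissible μ π Λᶜ x) :
    Gap μ π ρ m (m - 1) * Gap μ π ρ (m - 1) l ≤ gap μ π ρ Λ x l := by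
  have hcard := card_compl_of_card_eq hm hΛ
  set a := Gap μ π ρ m (m - 1) with ha
  set b := Gap μ π ρ (m - 1) l with hb
  have hb0 : 0 ≤ b := Gap_nonneg hπ (by omega) (by omega)
  have ha0 : 0 ≤ a := Gap_nonneg hπ hm (by omega)
  have ha1 : a ≤ 1 := (Gap_le_gap hπ hm (by omega) hΛ hx).trans gap_le_one
  -- Removing `i` from the block means freezing it, so the smaller sampler is the one for `insert i
  -- Λ`, which `Gap μ π ρ (m - 1) l` covers.
  have herase : ∀ i ∈ Λᶜ, (insert i Λ).card = n - (m - 1) := fun i hi => by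
    rw [Finset.card_insert_of_notMem (Finset.mem_compl.1 hi), hΛ]
    omega
  have hc : ∀ i ∈ Λᶜ, ∀ᵐ y ∂(condKernel (μ := μ) hπ Λᶜ x), ∀ f : (∀ i, X i) → ℝ, Measurable f →
      MemLp f 2 (condKernel (μ := μ) hπ (Λᶜ.erase i) y) →
      ∫ z, f z ∂(condKernel (μ := μ) hπ (Λᶜ.erase i) y) = 0 →
      eLpNorm (kernelAverage (condKernel (μ := μ) hπ) (Λᶜ.erase i) l f) 2
          (condKernel (μ := μ) hπ (Λᶜ.erase i) y) ≤
        ENNReal.ofReal (1 - b) * eLpNorm f 2 (condKernel (μ := μ) hπ (Λᶜ.erase i) y) ∧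
      b ≤ 1 := by
    intro i hi
    filter_upwards [ae_admissible hπ (Λᶜ.erase_subset i) hx] with y hy f hf hf2 hf0
    rw [← Finset.compl_insert] at *
    have hcard' := card_compl_of_card_eq (by omega) (herase i hi)
    have hle : b ≤ gap μ π ρ (insert i Λ) y l := Gap_le_gap hπ (by omega) (by omega) (herase i hi) hy
    refine ⟨(eLpNorm_kernelAverage_le_gap (ρ := ρ) hπ hy (by omega) hf hf2 hf0).trans ?_,
      hle.trans gap_le_one⟩
    gcongr
  obtain ⟨i, hi⟩ : Λᶜ.Nonempty := Finset.card_pos.1 (by omega)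
  -- Some admissible value exists because an a.e. property of a probability measure holds somewhere;
  -- the zero function serves only to extract `b ≤ 1` from `hc`.
  have hb1 : b ≤ 1 := by
    obtain ⟨y, hy⟩ := (hc i hi).exists
    exact (hy 0 measurable_zero MemLp.zero (by simp)).2
  have hab : 0 ≤ 1 - a * b := by nlinarith
  suffices h : opNorm (condLaw μ π ρ Λᶜ x) (gibbsKernel μ π ρ Λ x l) ≤
      ENNReal.ofReal (1 - a * b) by
    have := ENNReal.toReal_le_of_le_ofReal hab h
    rw [gap, spectralGap]
    linarith
  refine opNorm_gibbsKernel_le hπ hx fun f _ hf2 hf0 => ?_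
  have h := eLpNorm_kernelAverage_le_telescope (κ := condKernel (μ := μ) hπ)
    (M := condKernel (μ := μ) hπ Λᶜ x) (l := l) (c := 1 - b) (d := 1 - a)
    (fun Γ hΓ => condKernel_invariant hπ hΓ hx) (ae_integral_condKernel_eq_of_subset hπ hx)
    (by omega) (by linarith) (by linarith) (by linarith)
    (fun i hi => (hc i hi).mono fun y hy f hf hf2 hf0 => (hy f hf hf2 hf0).1)
    (fun f hf hf2 hf0 => ?_) hf2 hf0
  · simpa only [sub_sub_cancel] using h
  · refine (eLpNorm_kernelAverage_le_gap (ρ := ρ) hπ hx (by omega) hf hf2 hf0).trans ?_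
    rw [hcard]
    gcongr
    exact Gap_le_gap hπ hm (by omega) hΛ hx

theorem mul_Gap_le_Gap (hπ : Measurable π) (hπ1 : ∫⁻ x, π x ∂(Measure.pi μ) = 1)
    (hlm : l < m) (hm : m ≤ n) :
    Gap μ π ρ m (m - 1) * Gap μ π ρ (m - 1) l ≤ Gap μ π ρ m l := by
  refine le_csInf ?_ ?_
  · obtain ⟨Λ, -, hΛ⟩ := Finset.exists_subset_card_eq (s := (Finset.univ : Finset (Fin n)))
      (n := n - m) (by simp)
    obtain ⟨x, hx⟩ := exists_admissible hπ hπ1 Λᶜ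
    exact ⟨_, Λ, x, hΛ, hx, rfl⟩
  · rintro _ ⟨Λ, x, hΛ, hx, rfl⟩
    exact mul_Gap_le_gap hπ hlm hm hΛ hx

theorem prod_Gap_le_Gap (hπ : Measurable π) (hπ1 : ∫⁻ x, π x ∂(Measure.pi μ) = 1)
    (hlm : l + 1 ≤ m) (hm : m ≤ n) :
    ∏ k ∈ Finset.Icc (l + 1) m, Gap μ π ρ k (k - 1) ≤ Gap μ π ρ m l := by
  induction m, hlm using Nat.le_induction with
  -- The product has the single factor `Gap μ π ρ (l + 1) l`, so equality holds.
  | base => simp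
  | succ m hlm ih =>
    rw [Finset.prod_Icc_succ_top (by omega), mul_comm]
    refine le_trans ?_ (mul_Gap_le_Gap hπ hπ1 (by omega) hm)
    rw [Nat.add_sub_cancel]
    exact mul_le_mul_of_nonneg_left (ih (by omega)) (Gap_nonneg hπ hm (by omega))

end Gap
end SpectralTelescope

theorem theorem1 {n : ℕ} {X : Fin n → Type*} [∀ i, MeasurableSpace (X i)]
    (μ : ∀ i, Measure (X i)) [∀ i, SigmaFinite (μ i)]
    (π : (∀ i, X i) → ℝ≥0∞) (hπ : Measurable π) (hπ1 : ∫⁻ x, π x ∂(Measure.pi μ) = 1)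
    (ρ : (Γ : Finset (Fin n)) → (∀ i : ↥Γᶜ, X i) → (∀ i : Γ, X i) → ℝ≥0∞)
    (hρ : ∀ Γ : Finset (Fin n), Γ.Nonempty → ∀ u, Measurable (ρ Γ u) ∧
      ∫⁻ w, ρ Γ u w ∂(Measure.pi fun i : Γ => μ i) = 1) :
    (∀ l m : ℕ, 1 ≤ l → l + 1 ≤ m → m ≤ n →
      SpectralTelescope.Gap μ π ρ m (m - 1) * SpectralTelescope.Gap μ π ρ (m - 1) l
        ≤ SpectralTelescope.Gap μ π ρ m l) ∧
    (∀ l : ℕ, 1 ≤ l → l + 1 ≤ n →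
      ∏ m ∈ Finset.Icc (l + 1) n, SpectralTelescope.Gap μ π ρ m (m - 1)
        ≤ SpectralTelescope.Gap μ π ρ n l) :=
  ⟨fun _ _ _ hlm hm => SpectralTelescope.mul_Gap_le_Gap hπ hπ1 hlm hm,
    fun _ _ hl => SpectralTelescope.prod_Gap_le_Gap hπ hπ1 hl le_rfl⟩
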